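/- Let $\mathbb{H}\subset\mathbb{R}^2$ be the set of sites of the honeycomb lattice $H$ with hexagons of side length $1$ that contains the origin and the bond from $(0,0)$ to $(1,0)$; bonds join the sites at distance $1$. A particle with position $\mathbf r(t)\in\mathbb H$ and velocity $\mathbf v(t)\in\mathbb R^2$ moves in discrete time $t=0,1,2,\dots$ from $\mathbf r(0)=(0,0)$ and $\mathbf v(0)=(1,0)$, together with orientations $C(t,\mathbf h)\in\{-1,1\}$ of the scatterers at the sites $\mathbf h\in\mathbb H$ ($-1$ is a left scatterer, $1$ a right scatterer), according to $$\mathbf r(t+1)=\mathbf r(t)+\mathbf v(t),\qquad \mathbf v(t+1)=R\big[C(t,\mathbf r(t+1))\big]\mathbf v(t),$$ $$C(t+1,\mathbf h)=\begin{cases}-C(t,\mathbf h)&\text{if }\mathbf h=\mathbf r(t+1),\\ C(t,\mathbf h)&\text{otherwise,}\end{cases}\qquad R[z]=\begin{pmatrix}\cos\frac{\pi z}{3}&\sin\frac{\pi z}{3}\\-\sin\frac{\pi z}{3}&\cos\frac{\pi z}{3}\end{pmatrix}.$$ In the $(H;p)$ model, $p\in[0,1]$, the initial orientations $C(0,\mathbf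 h)$, $\mathbf h\in\mathbb H$, are independent random variables with $\mathbb P[C(0,\mathbf h)=1]=p$. Write $T[a,b]=\{\mathbf r(t):a\le t\le b\}$. The particle travels on a loop from time $a$ to time $b$ if $\mathbf r(a)=\mathbf r(b)$ and $\mathbf r(t)\ne\mathbf r(a)$ for $a<t<b$. The particle encounters a reflecting structure $T[t_1,t_2]$ at time $t_1$ if there is a time $t_*$ with $0<t_1<t_*<t_2$ such that (a) $T[t_1,t_*]$ and $T[t_*,t_2]$ are loops; (b) each of these two loops visits each of the sites $\mathbf r(t_1+1)$ and $\mathbf r(t_2-1)$ exactly once, i.e. at exactly one time in the time interval of the loop; and (c) $T[0,t_1-1]\cap T[t_1,t_2]=\emptyset$. **Statement.** If initially all scatterers are left scatterers, or if initially all scatterers are right scatterers, then the particle never encounters a reflecting structure. In particular, in the $(H;p)$ model with $p=0$ or $p=1$, with probability $1$ the particle never encounters a reflecting structure. -/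

import Mathlib

namespace FlippingRotator

/-- The Euclidean plane `ℝ²`. -/
abbrev Plane : Type := EuclideanSpace ℝ (Fin 2)

/-- The sites of the honeycomb lattice with hexagons of side length one that contains the origin
and the bond from `(0, 0)` to `(1, 0)`: the triangular lattice generated by `(3/2, √3/2)` and
`(3/2, -√3/2)`, together with its translate by `(1, 0)`. -/
def sites : Set Plane :=
  {x | ∃ m n : ℤ,
    x = !₂[3 / 2 * ((m : ℝ) + n), √3 / 2 * ((m : ℝ) - n)] ∨
    x = !₂[3 / 2 * ((m : ℝ) + n) + 1, √3 / 2 * ((m : ℝ) - n)]}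

/-- A lattice site. -/
abbrev Site : Type := sites

/-- The honeycomb lattice as a graph: its bonds join the sites at distance one. -/
def honeycomb : SimpleGraph Site where
  Adj x y := dist (x : Plane) (y : Plane) = 1
  symm := ⟨fun x y h => by rw [dist_comm]; exact h⟩
  loopless := ⟨fun x h => by simp at h⟩

/-- The matrix rotating by `π / 3` clockwise (to the right) if `z = 1` and counterclockwise
(to the left) if `z = -1`. -/
noncomputable def rotMatrix (z : ℤˣ) : Matrix (Fin 2) (Fin 2) ℝ :=
  !![Real.cos (Real.pi / 3 * ((z : ℤ) : ℝ)), Real.sin (Real.pi / 3 * ((z : ℤ) : ℝ));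
    -Real.sin (Real.pi / 3 * ((z : ℤ) : ℝ)), Real.cos (Real.pi / 3 * ((z : ℤ) : ℝ))]

/-- The action of the rotation matrix on the plane. -/
noncomputable def rot (z : ℤˣ) (v : Plane) : Plane :=
  WithLp.toLp 2 (Matrix.mulVec (rotMatrix z) v.ofLp)

/-- A configuration of scatterers: `1` is a right scatterer, `-1` is a left scatterer. -/
abbrev Config : Type := Site → ℤˣ

/-- A state `(r, v, C)` of the system. The velocity points along a bond of the lattice
that starts at the position. States also serve as initial conditions. -/
structure State where
  pos : Site
  vel : Plane
  config : Config
  bond : ∃ y : Site, honeycomb.Adj pos y ∧ (y : Plane) = (pos : Plane) + vel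

/-- The site that the particle reaches at the next time step. -/
def State.nextPos (s : State) : Site :=
  ⟨(s.pos : Plane) + s.vel, by
    obtain ⟨y, _, hy⟩ := s.bond
    rw [← hy]
    exact y.2⟩

theorem rot_apply_zero (z : ℤˣ) (v : Plane) :
    rot z v 0 = 1 / 2 * v 0 + √3 / 2 * ((z : ℤ) : ℝ) * v 1 := by
  rcases Int.units_eq_one_or z with rfl | rfl <;>
    simp [rot, rotMatrix, dotProduct, Fin.sum_univ_two, Real.cos_pi_div_three,
      Real.sin_pi_div_three]

theorem rot_apply_one (z : ℤˣ) (v : Plane) :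
    rot z v 1 = -(√3 / 2 * ((z : ℤ) : ℝ) * v 0) + 1 / 2 * v 1 := by
  rcases Int.units_eq_one_or z with rfl | rfl <;>
    simp [rot, rotMatrix, dotProduct, Fin.sum_univ_two, Real.cos_pi_div_three,
      Real.sin_pi_div_three]

theorem dist_eq_one_iff (x y : Plane) :
    dist x y = 1 ↔ (x 0 - y 0) ^ 2 + (x 1 - y 1) ^ 2 = 1 := by
  rw [EuclideanSpace.dist_eq, Fin.sum_univ_two, Real.sqrt_eq_one, Real.dist_eq, Real.dist_eq,
    sq_abs, sq_abs]

/-- If `3 s ^ 2 + 4 s + d ^ 2 = 0` for integers, then `(s, d)` is `(0, 0)`, `(-1, 1)` or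
`(-1, -1)`. -/
theorem bond_cases (s d : ℤ) (h : 3 * s ^ 2 + 4 * s + d ^ 2 = 0) :
    (s = 0 ∧ d = 0) ∨ (s = -1 ∧ d = 1) ∨ (s = -1 ∧ d = -1) := by
  have h1 : -2 < s := by nlinarith [sq_nonneg d]
  have h2 : s < 1 := by nlinarith [sq_nonneg d]
  interval_cases s
  · have : (d - 1) * (d + 1) = 0 := by linarith
    rcases mul_eq_zero.mp this with h | h
    · right; left; exact ⟨rfl, by linarith⟩
    · right; right; exact ⟨rfl, by linarith⟩
  · left
    exact ⟨rfl, by nlinarith⟩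

/-- A particle that arrives along a bond at a site leaves it along a bond, however it is
scattered there. -/
theorem exists_bond_rot (z : ℤˣ) (x y : Site) (v : Plane) (h : honeycomb.Adj x y)
    (hv : (y : Plane) = (x : Plane) + v) :
    ∃ w : Site, honeycomb.Adj y w ∧ (w : Plane) = (y : Plane) + rot z v := by
  have h3 : √3 ^ 2 = (3 : ℝ) := Real.sq_sqrt (by norm_num)
  have hadj : dist (x : Plane) (y : Plane) = 1 := h
  rw [dist_eq_one_iff] at hadj
  have hv0 : (y : Plane) 0 = (x : Plane) 0 + v 0 := by rw [hv]; rfl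
  have hv1 : (y : Plane) 1 = (x : Plane) 1 + v 1 := by rw [hv]; rfl
  have hnorm : v 0 ^ 2 + v 1 ^ 2 = 1 := by
    rw [hv0, hv1] at hadj; linarith
  have hz : ((z : ℤ) : ℝ) ^ 2 = 1 := by
    rcases Int.units_eq_one_or z with rfl | rfl <;> simp
  have r0 := rot_apply_zero z v
  have r1 := rot_apply_one z v
  have hrot : (rot z v 0) ^ 2 + (rot z v 1) ^ 2 = 1 := by
    rw [r0, r1]
    linear_combination (1 / 4 + 3 / 4 : ℝ) * hnorm +
      (v 0 ^ 2 + v 1 ^ 2) * ((z : ℤ) : ℝ) ^ 2 / 4 * h3 +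
      3 / 4 * (v 0 ^ 2 + v 1 ^ 2) * hz
  suffices hs : (y : Plane) + rot z v ∈ sites by
    refine ⟨⟨_, hs⟩, ?_, rfl⟩
    change dist _ _ = _
    rw [dist_eq_one_iff]
    simp only [PiLp.add_apply]
    linarith
  have key : ∀ a b : ℝ, (y : Plane) 0 + rot z v 0 = a → (y : Plane) 1 + rot z v 1 = b →
      (y : Plane) + rot z v = !₂[a, b] := by
    intro a b ha hb
    ext i
    fin_cases i
    · simpa using ha
    · simpa using hb
  obtain ⟨m, n, hx⟩ := x.2
  obtain ⟨k, l, hy⟩ := y.2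
  rcases hx with hx | hx <;> rcases hy with hy | hy
  · exfalso
    have e0 : v 0 = 3 / 2 * ((k + l - m - n : ℤ) : ℝ) := by
      rw [hx, hy] at hv0; simp at hv0; push_cast; linarith
    have e1 : v 1 = √3 / 2 * ((k - l - m + n : ℤ) : ℝ) := by
      rw [hx, hy] at hv1; simp at hv1; push_cast; linarith
    rw [e0, e1] at hnorm
    have e : (9 * (k + l - m - n) ^ 2 + 3 * (k - l - m + n) ^ 2 : ℤ) = 4 := by
      have : (9 * ((k + l - m - n : ℤ) : ℝ) ^ 2 + 3 * ((k - l - m + n : ℤ) : ℝ) ^ 2) = 4 := by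
        linear_combination 4 * hnorm - ((k - l - m + n : ℤ) : ℝ) ^ 2 * h3
      exact_mod_cast this
    omega
  · have e0 : v 0 = (3 / 2 * ((k + l - m - n : ℤ) : ℝ) + 1) := by
      rw [hx, hy] at hv0; simp at hv0; push_cast; linarith
    have e1 : v 1 = (√3 / 2 * ((k - l - m + n : ℤ) : ℝ)) := by
      rw [hx, hy] at hv1; simp at hv1; push_cast; linarith
    have e : 3 * (k + l - m - n : ℤ) ^ 2 + 4 * (k + l - m - n : ℤ) + (k - l - m + n : ℤ) ^ 2 = 0 := by
      have : (3 * ((k + l - m - n : ℤ) : ℝ) ^ 2 + 4 * ((k + l - m - n : ℤ) : ℝ) + ((k - l - m + n : ℤ) : ℝ) ^ 2) = 0 := by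
        rw [e0, e1] at hnorm
        linear_combination 4 / 3 * hnorm - ((k - l - m + n : ℤ) : ℝ) ^ 2 / 3 * h3
      exact_mod_cast this
    have y0 : (y : Plane) 0 = 3 / 2 * ((k : ℝ) + l) + 1 := by rw [hy]; simp
    have y1 : (y : Plane) 1 = √3 / 2 * ((k : ℝ) - l) := by rw [hy]; simp
    rcases bond_cases _ _ e with ⟨hs, hd⟩ | ⟨hs, hd⟩ | ⟨hs, hd⟩ <;>
      rw [hs] at e0 <;> rw [hd] at e1 <;> push_cast at e0 e1 <;>
      rcases Int.units_eq_one_or z with rfl | rfl <;>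
      rw [e0, e1] at r0 r1 <;> push_cast at r0 r1
    · refine ⟨k, l + 1, Or.inl (key _ _ ?_ ?_)⟩
      · rw [y0, r0]; push_cast; linarith
      · rw [y1, r1]; push_cast; linarith
    · refine ⟨k + 1, l, Or.inl (key _ _ ?_ ?_)⟩
      · rw [y0, r0]; push_cast; linarith
      · rw [y1, r1]; push_cast; linarith
    · refine ⟨k + 1, l, Or.inl (key _ _ ?_ ?_)⟩
      · rw [y0, r0]; push_cast; linarith
      · rw [y1, r1]; push_cast; linarith
    · refine ⟨k, l, Or.inl (key _ _ ?_ ?_)⟩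
      · rw [y0, r0]; push_cast; linarith
      · rw [y1, r1]; push_cast; linarith
    · refine ⟨k, l, Or.inl (key _ _ ?_ ?_)⟩
      · rw [y0, r0]; push_cast; linarith
      · rw [y1, r1]; push_cast; linarith
    · refine ⟨k, l + 1, Or.inl (key _ _ ?_ ?_)⟩
      · rw [y0, r0]; push_cast; linarith
      · rw [y1, r1]; push_cast; linarith
  · have e0 : v 0 = -(3 / 2 * ((m + n - k - l : ℤ) : ℝ) + 1) := by
      rw [hx, hy] at hv0; simp at hv0; push_cast; linarith
    have e1 : v 1 = -(√3 / 2 * ((m - n - k + l : ℤ) : ℝ)) := by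
      rw [hx, hy] at hv1; simp at hv1; push_cast; linarith
    have e : 3 * (m + n - k - l : ℤ) ^ 2 + 4 * (m + n - k - l : ℤ) + (m - n - k + l : ℤ) ^ 2 = 0 := by
      have : (3 * ((m + n - k - l : ℤ) : ℝ) ^ 2 + 4 * ((m + n - k - l : ℤ) : ℝ) + ((m - n - k + l : ℤ) : ℝ) ^ 2) = 0 := by
        rw [e0, e1] at hnorm
        linear_combination 4 / 3 * hnorm - ((m - n - k + l : ℤ) : ℝ) ^ 2 / 3 * h3
      exact_mod_cast this
    have y0 : (y : Plane) 0 = 3 / 2 * ((k : ℝ) + l) := by rw [hy]; simp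
    have y1 : (y : Plane) 1 = √3 / 2 * ((k : ℝ) - l) := by rw [hy]; simp
    rcases bond_cases _ _ e with ⟨hs, hd⟩ | ⟨hs, hd⟩ | ⟨hs, hd⟩ <;>
      rw [hs] at e0 <;> rw [hd] at e1 <;> push_cast at e0 e1 <;>
      rcases Int.units_eq_one_or z with rfl | rfl <;>
      rw [e0, e1] at r0 r1 <;> push_cast at r0 r1
    · refine ⟨k, l - 1, Or.inr (key _ _ ?_ ?_)⟩
      · rw [y0, r0]; push_cast; linarith
      · rw [y1, r1]; push_cast; linarith
    · refine ⟨k - 1, l, Or.inr (key _ _ ?_ ?_)⟩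
      · rw [y0, r0]; push_cast; linarith
      · rw [y1, r1]; push_cast; linarith
    · refine ⟨k - 1, l, Or.inr (key _ _ ?_ ?_)⟩
      · rw [y0, r0]; push_cast; linarith
      · rw [y1, r1]; push_cast; linarith
    · refine ⟨k, l, Or.inr (key _ _ ?_ ?_)⟩
      · rw [y0, r0]; push_cast; linarith
      · rw [y1, r1]; push_cast; linarith
    · refine ⟨k, l, Or.inr (key _ _ ?_ ?_)⟩
      · rw [y0, r0]; push_cast; linarith
      · rw [y1, r1]; push_cast; linarith
    · refine ⟨k, l - 1, Or.inr (key _ _ ?_ ?_)⟩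
      · rw [y0, r0]; push_cast; linarith
      · rw [y1, r1]; push_cast; linarith
  · exfalso
    have e0 : v 0 = 3 / 2 * ((k + l - m - n : ℤ) : ℝ) := by
      rw [hx, hy] at hv0; simp at hv0; push_cast; linarith
    have e1 : v 1 = √3 / 2 * ((k - l - m + n : ℤ) : ℝ) := by
      rw [hx, hy] at hv1; simp at hv1; push_cast; linarith
    rw [e0, e1] at hnorm
    have e : (9 * (k + l - m - n) ^ 2 + 3 * (k - l - m + n) ^ 2 : ℤ) = 4 := by
      have : (9 * ((k + l - m - n : ℤ) : ℝ) ^ 2 + 3 * ((k - l - m + n : ℤ) : ℝ) ^ 2) = 4 := by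
        linear_combination 4 * hnorm - ((k - l - m + n : ℤ) : ℝ) ^ 2 * h3
      exact_mod_cast this
    omega

/-- One time step of the equations of motion: the particle moves to `r + v`, is rotated by the
scatterer which it finds there, and flips that scatterer. -/
noncomputable def step (s : State) : State where
  pos := s.nextPos
  vel := rot (s.config s.nextPos) s.vel
  config := fun h => open scoped Classical in
    if h = s.nextPos then -s.config h else s.config h
  bond := by
    obtain ⟨y, hxy, hy⟩ := s.bond
    have e : s.nextPos = y := Subtype.ext hy.symm
    rw [e]
    exact exists_bond_rot _ s.pos y s.vel hxy hy

/-- The state at time `t` of the flipping rotator model with initial condition `I`. -/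
noncomputable def stateAt (I : State) (t : ℕ) : State := step^[t] I

/-- The position `r(t)` of the particle at time `t`. -/
noncomputable def r (I : State) (t : ℕ) : Site := (stateAt I t).pos

/-- The set `T[a, b]` of the positions of the particle from time `a` to time `b`. -/
def T (I : State) (a b : ℕ) : Set Site := r I '' Set.Icc a b

/-- The particle travels on a loop from time `a` to time `b`. -/
def IsLoop (I : State) (a b : ℕ) : Prop :=
  r I a = r I b ∧ ∀ t, a < t → t < b → r I t ≠ r I a

/-- From time `a` to time `b` the particle visits the site `h` exactly once. -/
def VisitsOnce (I : State) (a b : ℕ) (h : Site) : Prop :=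
  ∃! t : ℕ, t ∈ Set.Icc a b ∧ r I t = h

/-- `T[t₁, t₂]` is a reflecting structure of the model with initial condition `I`. -/
def IsReflectingStructure (I : State) (t₁ t₂ : ℕ) : Prop :=
  ∃ t' : ℕ, 0 < t₁ ∧ t₁ < t' ∧ t' < t₂ ∧
    (IsLoop I t₁ t' ∧ IsLoop I t' t₂) ∧
    (VisitsOnce I t₁ t' (r I (t₁ + 1)) ∧ VisitsOnce I t₁ t' (r I (t₂ - 1)) ∧
      VisitsOnce I t' t₂ (r I (t₁ + 1)) ∧ VisitsOnce I t' t₂ (r I (t₂ - 1))) ∧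
    T I 0 (t₁ - 1) ∩ T I t₁ t₂ = ∅

/-- The particle encounters a reflecting structure at time `t₁`. -/
def EncountersReflectingStructure (I : State) (t₁ : ℕ) : Prop :=
  ∃ t₂ : ℕ, IsReflectingStructure I t₁ t₂

/-- The initial condition with position `(0, 0)`, velocity `(1, 0)` and configuration `C`. -/
def initial (C : Config) : State where
  pos := ⟨!₂[0, 0], 0, 0, Or.inl (by simp)⟩
  vel := !₂[1, 0]
  config := C
  bond := by
    refine ⟨⟨!₂[1, 0], 0, 0, Or.inr (by simp)⟩, ?_, ?_⟩
    · change dist _ _ = _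
      rw [dist_eq_one_iff]
      simp
    · ext i
      fin_cases i <;> simp

open MeasureTheory ProbabilityTheory in
/-- `C` is the random initial configuration of the `(H; p)` model: the orientations are
independent, and each scatterer is a right scatterer with probability `p`. -/
structure IsRandomConfig {Ω : Type*} [MeasurableSpace Ω] (P : Measure Ω) (p : ℝ)
    (C : Site → Ω → ℤˣ) : Prop where
  measurable : ∀ h, Measurable (C h)
  indep : iIndepFun C P
  prob : ∀ h, P {ω | C h ω = 1} = ENNReal.ofReal p

end FlippingRotator

namespace FlippingRotator

/-! Suppose a reflecting structure begins at time `a + 1`. By condition (c), none of its sites was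
visited up to time `a`, so from `r(a)` on the particle meets unflipped scatterers, all turning it
the same way, until it revisits a site. It therefore traces a hexagon with first corner `r(a)`
(`motion_on_hexagon`). If the structure lasts until time `a + 6`, it contains the old site `r(a)`,
against (c). If it ends sooner, its first loop would have to close among distinct corners of that
hexagon. For `p = 0` or `p = 1` the random configuration is almost surely constant, because there
are countably many sites. -/

/-! ### Equations of motion. -/

theorem stateAt_succ (I : State) (t : ℕ) : stateAt I (t + 1) = step (stateAt I t) :=
  Function.iterate_succ_apply' step t I

theorem r_succ (I : State) (t : ℕ) :
    (r I (t + 1) : Plane) = (r I t : Plane) + (stateAt I t).vel := by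
  simp only [r, stateAt_succ]
  rfl

theorem vel_succ (I : State) (t : ℕ) :
    (stateAt I (t + 1)).vel = rot ((stateAt I t).config (r I (t + 1))) (stateAt I t).vel := by
  simp only [r, stateAt_succ]
  rfl

/-- A scatterer that has not been visited keeps its initial orientation. -/
theorem config_of_not_visited (I : State) (t : ℕ) (h : Site)
    (hh : ∀ s, 1 ≤ s → s ≤ t → r I s ≠ h) : (stateAt I t).config h = I.config h := by
  induction t with
  | zero => rfl
  | succ t ih =>
    have hne : h ≠ (stateAt I t).nextPos := by
      have := hh (t + 1) (by omega) le_rfl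
      simp only [r, stateAt_succ] at this
      exact fun e => this e.symm
    rw [stateAt_succ, ← ih fun s hs hst => hh s hs (by omega)]
    exact if_neg hne

theorem vel_norm (s : State) : s.vel 0 ^ 2 + s.vel 1 ^ 2 = 1 := by
  obtain ⟨y, hadj, hy⟩ := s.bond
  have h1 : dist (s.pos : Plane) (y : Plane) = 1 := hadj
  rw [dist_eq_one_iff, hy] at h1
  simp only [PiLp.add_apply] at h1
  linarith

/-! ### Integer coordinates on a hexagon. -/

/-- The vector with coordinates `c` in the basis formed by `v` and its rotated copy. -/
noncomputable def hexVec (z : ℤˣ) (v : Plane) (c : ℤ × ℤ) : Plane :=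
  (c.1 : ℝ) • v + (c.2 : ℝ) • rot z v

theorem hexVec_add (z : ℤˣ) (v : Plane) (c d : ℤ × ℤ) :
    hexVec z v (c + d) = hexVec z v c + hexVec z v d := by
  simp only [hexVec, Prod.fst_add, Prod.snd_add, Int.cast_add]
  module

theorem sq_unit_cast (z : ℤˣ) : ((z : ℤ) : ℝ) ^ 2 = 1 := by
  rcases Int.units_eq_one_or z with rfl | rfl <;> simp

/-- A rotation `R` by `±π/3` satisfies `R² = R - 1`, so it acts on the coordinates by an integer
matrix that does not depend on `z`. -/
theorem rot_hexVec (z : ℤˣ) (v : Plane) (c : ℤ × ℤ) :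
    rot z (hexVec z v c) = hexVec z v (-c.2, c.1 + c.2) := by
  have h3 : √3 ^ 2 = (3 : ℝ) := Real.sq_sqrt (by norm_num)
  have hz := sq_unit_cast z
  ext i
  fin_cases i
  · simp only [hexVec, Fin.zero_eta, rot_apply_zero, rot_apply_one, PiLp.add_apply,
      PiLp.smul_apply, smul_eq_mul]
    push_cast
    linear_combination (-(c.2 : ℝ) * v 0 * ((z : ℤ) : ℝ) ^ 2 / 4) * h3 -
      (3 / 4 * (c.2 : ℝ) * v 0) * hz
  · simp only [hexVec, Fin.mk_one, rot_apply_zero, rot_apply_one, PiLp.add_apply,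
      PiLp.smul_apply, smul_eq_mul]
    push_cast
    linear_combination (-(c.2 : ℝ) * v 1 * ((z : ℤ) : ℝ) ^ 2 / 4) * h3 -
      (3 / 4 * (c.2 : ℝ) * v 1) * hz

/-- A unit vector and its rotated copy are linearly independent. Distinctness of sites thus reduces
to distinctness of integer pairs, which is decidable. -/
theorem hexVec_injective (z : ℤˣ) (v : Plane) (hv : v 0 ^ 2 + v 1 ^ 2 = 1) :
    Function.Injective (hexVec z v) := by
  have h3 : √3 ^ 2 = (3 : ℝ) := Real.sq_sqrt (by norm_num)
  have hz := sq_unit_cast z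
  intro c d h
  have e0 : hexVec z v c 0 = hexVec z v d 0 := by rw [h]
  have e1 : hexVec z v c 1 = hexVec z v d 1 := by rw [h]
  simp only [hexVec, rot_apply_zero, rot_apply_one, PiLp.add_apply, PiLp.smul_apply,
    smul_eq_mul] at e0 e1
  -- The cross product with `v` eliminates the first coordinates; the inner product with `v` then
  -- gives `ha`.
  have hb : √3 / 2 * ((z : ℤ) : ℝ) * ((c.2 : ℝ) - d.2) = 0 := by
    linear_combination v 1 * e0 - v 0 * e1 -
      √3 / 2 * ((z : ℤ) : ℝ) * ((c.2 : ℝ) - d.2) * hv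
  have hb' : (c.2 : ℝ) = d.2 := by
    linear_combination (2 / 3 * √3 * ((z : ℤ) : ℝ)) * hb -
      ((c.2 : ℝ) - d.2) * ((z : ℤ) : ℝ) ^ 2 / 3 * h3 - ((c.2 : ℝ) - d.2) * hz
  rw [hb'] at e0 e1
  have ha : (c.1 : ℝ) = d.1 := by
    linear_combination v 0 * e0 + v 1 * e1 - ((c.1 : ℝ) - d.1) * hv
  exact Prod.ext (by exact_mod_cast ha) (by exact_mod_cast hb')

/-- Coordinates of the velocity after `k` turns in the same direction. -/
def hexVel : ℕ → ℤ × ℤ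
  | 0 => (1, 0)
  | k + 1 => (-(hexVel k).2, (hexVel k).1 + (hexVel k).2)

/-- Coordinates of the `k`-th corner of the hexagon traced by turning in the same direction. -/
def hexPos : ℕ → ℤ × ℤ
  | 0 => (0, 0)
  | k + 1 => hexPos k + hexVel k

theorem hexPos_ne : ∀ k < 6, ∀ j < k, hexPos j ≠ hexPos k := by decide

theorem hexPos_six : hexPos 6 = (0, 0) := by decide

/-! ### Motion through new sites. -/

/-- On scatterers of orientation `z` that were not visited before time `a`, the particle
moves along the boundary of a hexagon. -/
theorem motion_on_hexagon (z : ℤˣ) (I : State) (hI : ∀ h, I.config h = z) (a n : ℕ)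
    (hfresh : ∀ s ≤ a, ∀ t, a < t → t ≤ n → r I s ≠ r I t) (k : ℕ) (hk : k ≤ 5)
    (hkn : a + k ≤ n) :
    (∀ j ≤ k, (r I (a + j) : Plane) = r I a + hexVec z (stateAt I a).vel (hexPos j)) ∧
      (stateAt I (a + k)).vel = hexVec z (stateAt I a).vel (hexVel k) := by
  induction k with
  | zero =>
    refine ⟨fun j hj => ?_, by simp [hexVec, hexVel]⟩
    obtain rfl : j = 0 := by omega
    simp [hexVec, hexPos]
  | succ k ih =>
    obtain ⟨ihp, ihv⟩ := ih (by omega) (by omega)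
    have hpos : (r I (a + (k + 1)) : Plane) =
        r I a + hexVec z (stateAt I a).vel (hexPos (k + 1)) := by
      rw [← add_assoc, r_succ, ihv, ihp k le_rfl, hexPos, hexVec_add, add_assoc]
    refine ⟨fun j hj => ?_, ?_⟩
    · rcases hj.eq_or_lt with rfl | hj
      · exact hpos
      · exact ihp j (by omega)
    -- The scatterer at corner `k + 1` is unflipped: `hfresh` excludes visits up to time `a`, and
    -- later visits were to other corners, as `k + 1 ≤ 5`.
    · rw [← add_assoc, vel_succ, config_of_not_visited, hI, ihv, rot_hexVec, hexVel]
      intro s _ hs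
      rcases le_or_gt s a with hsa | hsa
      · exact hfresh s hsa _ (by omega) (by omega)
      · obtain ⟨j, rfl⟩ := Nat.exists_eq_add_of_le hsa.le
        intro e
        have e' := congrArg (Subtype.val) e
        rw [ihp j (by omega), add_assoc a, hpos] at e'
        exact hexPos_ne (k + 1) (by omega) j (by omega)
          (hexVec_injective z _ (vel_norm _) (add_left_cancel e'))

/-- If all scatterers have the same orientation, then the particle follows the boundary of a hexagon
through any set of new sites, so that it meets an old site before it can close a loop there. -/
theorem not_encounters_of_uniform (z : ℤˣ) (I : State) (hI : ∀ h, I.config h = z) (t : ℕ) :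
    ¬ EncountersReflectingStructure I t := by
  rintro ⟨t₂, t', h0, h1, h2, ⟨⟨hloop, -⟩, -⟩, -, hdisj⟩
  obtain ⟨a, rfl⟩ : ∃ a, t = a + 1 := ⟨t - 1, by omega⟩
  have hfresh : ∀ s ≤ a, ∀ t, a < t → t ≤ t₂ → r I s ≠ r I t := by
    intro s hs t hat ht e
    have hmem : r I s ∈ T I 0 (a + 1 - 1) ∩ T I (a + 1) t₂ :=
      ⟨⟨s, ⟨Nat.zero_le _, by omega⟩, rfl⟩, ⟨t, ⟨hat, ht⟩, e.symm⟩⟩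
    rw [hdisj] at hmem
    exact hmem
  rcases le_or_gt (a + 6) t₂ with h6 | h6
  · obtain ⟨hp, hv⟩ := motion_on_hexagon z I hI a t₂ hfresh 5 le_rfl (by omega)
    refine hfresh a le_rfl (a + 6) (by omega) h6 (Subtype.ext ?_)
    -- The position at time `a + 6` depends only on the position and velocity at time `a + 5`, so
    -- five turns are enough to close the hexagon.
    have e := r_succ I (a + 5)
    rw [hv, hp 5 le_rfl, add_assoc (r I a : Plane), ← hexVec_add] at e
    change (r I (a + 6) : Plane) = r I a + hexVec z _ (hexPos 6) at e
    rw [e, hexPos_six]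
    simp [hexVec]
  -- Here `a + 1 < t' < t₂ ≤ a + 5`, so `t' = a + j` with `2 ≤ j ≤ 4`, and corner `j` differs from
  -- corner `1`.
  · obtain ⟨j, rfl⟩ := Nat.exists_eq_add_of_le (show a ≤ t' by omega)
    obtain ⟨hp, -⟩ := motion_on_hexagon z I hI a t₂ hfresh j (by omega) (by omega)
    have e := congrArg Subtype.val hloop
    rw [hp 1 (by omega), hp j le_rfl] at e
    exact hexPos_ne j (by omega) 1 (by omega)
      (hexVec_injective z _ (vel_norm _) (add_left_cancel e))

/-! ### Random configurations with `p = 0` or `p = 1`. -/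

theorem countable_sites : sites.Countable := by
  have : sites = (Set.range fun p : ℤ × ℤ =>
        (!₂[3 / 2 * ((p.1 : ℝ) + p.2), √3 / 2 * ((p.1 : ℝ) - p.2)] : Plane)) ∪
      Set.range fun p : ℤ × ℤ =>
        (!₂[3 / 2 * ((p.1 : ℝ) + p.2) + 1, √3 / 2 * ((p.1 : ℝ) - p.2)] : Plane) := by
    ext x
    simp only [sites, Set.mem_ofPred_eq, Set.mem_union, Set.mem_range, Prod.exists, exists_or,
      eq_comm]
  rw [this]
  exact (Set.countable_range _).union (Set.countable_range _)

open MeasureTheory in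
/-- For `p = 0` and `p = 1` the random configuration is almost surely constant. -/
theorem IsRandomConfig.ae_uniform {Ω : Type*} [MeasurableSpace Ω] {P : Measure Ω}
    [IsProbabilityMeasure P] {p : ℝ} {C : Site → Ω → ℤˣ} (hC : IsRandomConfig P p C)
    (hp : p = 0 ∨ p = 1) : ∃ z : ℤˣ, ∀ᵐ ω ∂P, ∀ h, C h ω = z := by
  have : Countable Site := countable_sites.to_subtype
  rcases hp with rfl | rfl
  · refine ⟨-1, ae_all_iff.2 fun h => ?_⟩
    have h0 : ∀ᵐ ω ∂P, C h ω ≠ 1 := by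
      simpa [ae_iff] using hC.prob h
    filter_upwards [h0] with ω hω
    exact (Int.units_eq_one_or _).resolve_left hω
  · refine ⟨1, ae_all_iff.2 fun h => ?_⟩
    -- The σ-algebra on `ℤˣ` is pulled back from `ℤ`, so the witness is the singleton `{1}` in `ℤ`.
    have h1 : MeasurableSet ({1} : Set ℤˣ) := ⟨{1}, measurableSet_singleton 1, by ext; simp⟩
    have hm : MeasurableSet {ω | C h ω = 1} := hC.measurable h h1
    exact (mem_ae_iff_prob_eq_one hm).2 (by simpa using hC.prob h)

end FlippingRotator

open MeasureTheory FlippingRotator in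
theorem mainTheorem6 :
    (∀ t : ℕ, ¬ EncountersReflectingStructure (initial fun _ => -1) t) ∧
    (∀ t : ℕ, ¬ EncountersReflectingStructure (initial fun _ => 1) t) ∧
    ∀ {Ω : Type*} [MeasurableSpace Ω] (P : Measure Ω) [IsProbabilityMeasure P]
      (p : ℝ) (C : Site → Ω → ℤˣ), p = 0 ∨ p = 1 → IsRandomConfig P p C →
      ∀ᵐ ω ∂P, ∀ t : ℕ, ¬ EncountersReflectingStructure (initial fun h => C h ω) t := by
  refine ⟨not_encounters_of_uniform (-1) _ fun _ => rfl,
    not_encounters_of_uniform 1 _ fun _ => rfl, fun {Ω} _ P _ p C hp hC => ?_⟩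
  obtain ⟨z, hz⟩ := hC.ae_uniform hp
  filter_upwards [hz] with ω hω
  exact not_encounters_of_uniform z _ hω
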